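/- Let $d \ge n \ge 1$, let $\theta_1,\dots,\theta_n \in \mathbb{R}^d$, and let $f=(f_1,\dots,f_n)$ be a probability vector. The state $\omega$ has the prior $\mu=\mathcal{N}(0,I)$ on $\mathbb{R}^d$. A buyer has type $i$ with probability $f_i$; the type is known only to the buyer, and a buyer of type $i$ who takes the action $a\in\mathbb{R}$ in state $\omega$ gets utility $u^i(\omega,a)=-(\theta_i^\top\omega-a)^2$. An experiment $E=(S,\pi)$ consists of a measurable space $S$ of signals and a Markov kernel $\pi$ from $\mathbb{R}^d$ to $S$; its value for type $i$ is $V(E,i)=\mathbb{E}_{s}\big[\max_{a\in\mathbb{R}}\mathbb{E}[u^i(\omega,a)\mid s]\big]$, where $\omega\sim\mu$ and $s\sim\pi(\cdot\mid\omega)$. A menu is a set $\mathcal{E}$ of experiments with prices $t:\mathcal{E}\to\mathbb{R}_{\ge 0}$. Facing a menu, each type $i$ either buys an experiment $E\in\mathcal{E}$, with net utility $V(E,i)-t(E)$, or buys nothing, with net utility $\max_{a\in\mathbb{R}}\mathbb{E}[u^i(\omega,a)]$, and it chooses an option of maximal net utility. The revenue is the expected payment $\sum_i f_i t^i$, where $t^i$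 is the payment of type $i$. A menu, together with such optimal choices of the types, is revenue-maximizing if no menu with optimal choices from it has a larger revenue. Then there exists a revenue-maximizing menu composed entirely of deterministic experiments. More precisely, there is a revenue-maximizing menu from which every type buys an experiment, every experiment on which is bought by some type, and every experiment on which reveals without noise a scalar signal $v^\top\omega$ for some unit vector $v\in\mathbb{R}^d$ (that is, it is a scalar Gaussian experiment $\mathcal{N}(v^\top\omega,\sigma^2)$ with $\sigma=0$). -/

import Mathlib

open MeasureTheory ProbabilityTheory
open scoped NNReal

noncomputable section

namespace DataMarket

/-- The state space `ℝ^d` with its Euclidean structure. -/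
abbrev State (d : ℕ) : Type := EuclideanSpace ℝ (Fin d)

/-- The common prior: the standard Gaussian distribution `N(0, I)` on `ℝ^d`. -/
abbrev prior (d : ℕ) : Measure (State d) := stdGaussian (State d)

/-- Ex-post utility `-(θᵀ ω - a)²` of a buyer with preference vector `θ` who takes the real
action `a` in state `ω`. -/
def utility {d : ℕ} (θ ω : State d) (a : ℝ) : ℝ := -(inner ℝ θ ω - a) ^ 2

/-- A statistical experiment: a measurable space of signals together with a signaling function,
i.e. a Markov kernel from states to signals. -/
structure Experiment (d : ℕ) where
  Signal : Type
  [measurableSignal : MeasurableSpace Signal]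
  π : Kernel (State d) Signal
  [markov : IsMarkovKernel π]

attribute [instance] Experiment.measurableSignal Experiment.markov

/-- The best expected utility that a buyer with preference vector `θ` can obtain under the
belief `ν` about the state. -/
def optimalUtility {d : ℕ} (θ : State d) (ν : Measure (State d)) : ℝ :=
  ⨆ a : ℝ, ∫ ω, utility θ ω a ∂ν

/-- The utility of a buyer who acts on the prior alone. -/
def baseline {d : ℕ} (θ : State d) : ℝ := optimalUtility θ (prior d)

namespace Experiment

/-- The distribution of the signal when the state is drawn from the prior. -/
def signalLaw {d : ℕ} (E : Experiment d) : Measure E.Signal := (prior d).bind E.π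

/-- The belief of a buyer who has observed the signal `s` from `E` (the conditional law of the
state given the signal). -/
def belief {d : ℕ} (E : Experiment d) (s : E.Signal) : Measure (State d) :=
  posterior E.π (prior d) s

/-- The value `V(E, θ)` of an experiment: the expectation over the signals of the best expected
utility under the posterior belief. -/
def value {d : ℕ} (E : Experiment d) (θ : State d) : ℝ :=
  ∫ s, optimalUtility θ (E.belief s) ∂E.signalLaw

/-- An experiment is deterministic if its signal is a function of the state. -/
def IsDeterministic {d : ℕ} (E : Experiment d) : Prop :=
  ∃ g : State d → E.Signal, Measurable g ∧ ∀ ω, E.π ω = Measure.dirac (g ω)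

/-- The scalar Gaussian experiment whose signal in state `ω` is drawn from `N(vᵀ ω, s)`, where
`s` is the variance of the noise. For `s = 0` the signal is exactly `vᵀ ω`. -/
def scalarGaussian {d : ℕ} (v : State d) (s : ℝ≥0) : Experiment d where
  Signal := ℝ
  π :=
    { toFun := fun ω => gaussianReal (inner ℝ v ω) s
      measurable' := measurable_gaussianReal.comp
        ((by fun_prop : Measurable fun ω : State d => (inner ℝ v ω : ℝ)).prodMk
          measurable_const) }
  markov := ⟨fun ω => by
    change IsProbabilityMeasure (gaussianReal (inner ℝ v ω) s)
    infer_instance⟩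

end Experiment

/-- A menu: a set of experiments, each with a nonnegative price. -/
structure Menu (d : ℕ) where
  experiments : Set (Experiment d)
  price : experiments → ℝ≥0

namespace Menu

variable {d : ℕ}

/-- What a buyer can do when facing a menu: buy one experiment on it, or (`none`) buy nothing. -/
abbrev Choice (M : Menu d) : Type 1 := Option M.experiments

/-- The amount paid. -/
def payment (M : Menu d) : M.Choice → ℝ
  | none => 0
  | some E => M.price E

/-- The expected net utility of a buyer with preference vector `θ`. -/
def netUtility (M : Menu d) (θ : State d) : M.Choice → ℝ
  | none => baseline θ
  | some E => E.1.value θ - M.price E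

/-- `c` is a profile of optimal choices: the choice `c i` of each type `i` maximizes the net
utility of that type over all experiments on the menu and the option not to buy. -/
def IsOptimalChoice {n : ℕ} (M : Menu d) (θ : Fin n → State d) (c : Fin n → M.Choice) : Prop :=
  ∀ i, ∀ x : M.Choice, M.netUtility (θ i) x ≤ M.netUtility (θ i) (c i)

/-- Expected revenue when the type `i` has probability `f i` and makes the choice `c i`. -/
def revenue {n : ℕ} (M : Menu d) (f : Fin n → ℝ) (c : Fin n → M.Choice) : ℝ :=
  ∑ i, f i * M.payment (c i)

/-- The menu `M`, from which the types make the choices `c`, is revenue-maximizing: the choices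
are optimal, and no menu with optimal choices from it, over arbitrary experiments and prices,
earns more. -/
def IsRevenueMaximizing {n : ℕ} (M : Menu d) (f : Fin n → ℝ) (θ : Fin n → State d)
    (c : Fin n → M.Choice) : Prop :=
  M.IsOptimalChoice θ c ∧
    ∀ (M' : Menu d) (c' : Fin n → M'.Choice), M'.IsOptimalChoice θ c' →
      M'.revenue f c' ≤ M.revenue f c

end Menu

end DataMarket

end

noncomputable section

namespace DataMarket

variable {d : ℕ}

/-! Under quadratic loss an experiment matters only through the second-moment matrix C of its
posterior mean: its value for θ exceeds the baseline by θᵀCθ (`value_eq`), and C ≤ I. For a purchase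
by type θ with θᵀCθ > 0, put v = Cθ/√(θᵀCθ). By Cauchy–Schwarz, vvᵀ ≤ C with equality of the forms
at θ, so replacing C by vvᵀ keeps the buyer's value and makes the item no more tempting to others
(`exists_linear_signal`). Here ‖v‖ ≤ 1. Since n ≤ d, some nonzero u is orthogonal to all the other
types; moving v along u to the unit sphere changes only the buyer's value, upwards, and the price
absorbs the increase (`exists_unit_signal`). A unit v is realized by revealing vᵀω, whose posterior
mean is (vᵀω)v (`gain_scalarGaussian_zero`). Every menu is thus matched in revenue by a point of the
compact set `linearMechanisms`, on which revenue attains its maximum. -/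

theorem memLp_inner {ν : Measure (State d)} (h : MemLp id 2 ν) (θ : State d) :
    MemLp (fun ω => (inner ℝ θ ω : ℝ)) 2 ν := by
  have := (innerSL ℝ θ).comp_memLp' h
  exact this

/-- Under a square-integrable belief, the best action is the posterior mean. -/
theorem optimalUtility_eq {ν : Measure (State d)} [IsProbabilityMeasure ν]
    (h : MemLp id 2 ν) (θ : State d) :
    optimalUtility θ ν = (inner ℝ θ (∫ ω, ω ∂ν) : ℝ) ^ 2 - ∫ ω, (inner ℝ θ ω : ℝ) ^ 2 ∂ν := by
  have hX := memLp_inner h θ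
  have hX1 : Integrable (fun ω => (inner ℝ θ ω : ℝ)) ν := hX.integrable (by norm_num)
  have hX2 : Integrable (fun ω => (inner ℝ θ ω : ℝ) ^ 2) ν := hX.integrable_sq
  have hm : ∫ ω, (inner ℝ θ ω : ℝ) ∂ν = inner ℝ θ (∫ ω, ω ∂ν) :=
    integral_inner (h.integrable (by norm_num)) θ
  have key : ∀ a : ℝ, ∫ ω, utility θ ω a ∂ν =
      (inner ℝ θ (∫ ω, ω ∂ν) : ℝ) ^ 2 - ∫ ω, (inner ℝ θ ω : ℝ) ^ 2 ∂ν
        - (a - inner ℝ θ (∫ ω, ω ∂ν)) ^ 2 := by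
    intro a
    have : ∀ ω, utility θ ω a = 2 * a * (inner ℝ θ ω : ℝ) - (inner ℝ θ ω : ℝ) ^ 2 - a ^ 2 := by
      intro ω; unfold utility; ring
    simp_rw [this]
    have h1 : Integrable (fun ω => 2 * a * (inner ℝ θ ω : ℝ)) ν := hX1.const_mul _
    have h2 : Integrable (fun ω => 2 * a * (inner ℝ θ ω : ℝ) - (inner ℝ θ ω : ℝ) ^ 2) ν :=
      h1.sub hX2
    rw [integral_sub h2 (integrable_const _), integral_sub h1 hX2, integral_const_mul, hm]
    simp
    ring
  unfold optimalUtility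
  apply le_antisymm
  · exact ciSup_le fun a => by rw [key]; nlinarith [sq_nonneg (a - inner ℝ θ (∫ ω, ω ∂ν))]
  · refine le_ciSup_of_le ⟨(inner ℝ θ (∫ ω, ω ∂ν) : ℝ) ^ 2 - ∫ ω, (inner ℝ θ ω : ℝ) ^ 2 ∂ν, ?_⟩
      (inner ℝ θ (∫ ω, ω ∂ν)) (by rw [key]; simp)
    rintro _ ⟨a, rfl⟩
    simp only [key]
    nlinarith [sq_nonneg (a - inner ℝ θ (∫ ω, ω ∂ν))]

theorem sq_norm_integral_le {ν : Measure (State d)} [IsProbabilityMeasure ν]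
    (h : MemLp id 2 ν) : ‖∫ ω, ω ∂ν‖ ^ 2 ≤ ∫ ω, ‖ω‖ ^ 2 ∂ν := by
  have h1 : ‖∫ ω, ω ∂ν‖ ≤ ∫ ω, ‖ω‖ ∂ν := norm_integral_le_integral_norm _
  have h2 := variance_nonneg (fun ω : State d => ‖ω‖) ν
  have hn : MemLp (fun ω : State d => ‖ω‖) 2 ν := h.norm
  rw [variance_eq_sub hn] at h2
  simp only [Pi.pow_apply] at h2
  have := pow_le_pow_left₀ (norm_nonneg _) h1 2
  linarith

theorem integral_inner_eq {ν : Measure (State d)} [IsProbabilityMeasure ν]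
    (h : MemLp id 2 ν) (θ : State d) :
    ∫ ω, (inner ℝ θ ω : ℝ) ∂ν = inner ℝ θ (∫ ω, ω ∂ν) :=
  integral_inner (h.integrable (by norm_num)) θ

theorem sq_inner_integral_le {ν : Measure (State d)} [IsProbabilityMeasure ν]
    (h : MemLp id 2 ν) (θ : State d) :
    (inner ℝ θ (∫ ω, ω ∂ν) : ℝ) ^ 2 ≤ ∫ ω, (inner ℝ θ ω : ℝ) ^ 2 ∂ν := by
  have h2 := variance_nonneg (fun ω : State d => (inner ℝ θ ω : ℝ)) ν
  rw [variance_eq_sub (memLp_inner h θ), integral_inner_eq h] at h2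
  simp only [Pi.pow_apply] at h2
  linarith

theorem memLp_id_prior (d : ℕ) : MemLp id 2 (prior d) := IsGaussian.memLp_two_id

theorem integral_id_prior (d : ℕ) : ∫ ω, ω ∂(prior d) = 0 := integral_id_stdGaussian

theorem integral_sq_inner_prior (θ : State d) :
    ∫ ω, (inner ℝ θ ω : ℝ) ^ 2 ∂(prior d) = ‖θ‖ ^ 2 := by
  have h := variance_dual_stdGaussian (innerSL ℝ θ)
  have h0 : ∫ ω, (inner ℝ θ ω : ℝ) ∂(prior d) = 0 := by
    rw [integral_inner_eq (memLp_id_prior d), integral_id_prior]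
    simp
  rw [innerSL_apply_norm] at h
  have h' : Var[fun ω => (inner ℝ θ ω : ℝ); prior d] = ‖θ‖ ^ 2 := h
  rw [← h', variance_eq_sub (memLp_inner (memLp_id_prior d) θ), h0]
  simp

theorem baseline_eq (θ : State d) : baseline θ = -‖θ‖ ^ 2 := by
  rw [baseline, optimalUtility_eq (memLp_id_prior d), integral_id_prior, integral_sq_inner_prior]
  simp

/-! ### Posterior means and the gain from an experiment -/

namespace Experiment

instance (E : Experiment d) : IsProbabilityMeasure E.signalLaw := by
  unfold signalLaw; infer_instance

instance (E : Experiment d) (s : E.Signal) : IsProbabilityMeasure (E.belief s) := by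
  unfold belief; infer_instance

/-- The conditional mean of the state given the signal. -/
def mean (E : Experiment d) (s : E.Signal) : State d := ∫ ω, ω ∂(E.belief s)

/-- The reduction of the expected squared error brought about by an experiment. -/
def gain (E : Experiment d) (θ : State d) : ℝ :=
  ∫ s, (inner ℝ θ (E.mean s) : ℝ) ^ 2 ∂E.signalLaw

theorem posterior_comp_signalLaw (E : Experiment d) :
    (posterior E.π (prior d)) ∘ₘ E.signalLaw = prior d :=
  posterior_comp_self

theorem integrable_of_prior (E : Experiment d) {g : State d → ℝ} (hg : Integrable g (prior d)) :
    Integrable g ((posterior E.π (prior d)) ∘ₘ E.signalLaw) := by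
  rwa [posterior_comp_signalLaw]

/-- Beliefs average to the prior, whose second moment is finite. -/
theorem ae_memLp_belief (E : Experiment d) : ∀ᵐ s ∂E.signalLaw, MemLp id 2 (E.belief s) := by
  have h : Integrable (fun ω : State d => ‖ω‖ ^ 2) (prior d) :=
    (memLp_id_prior d).norm.integrable_sq
  filter_upwards [Measure.ae_integrable_of_integrable_comp (E.integrable_of_prior h)] with s hs
  exact (memLp_two_iff_integrable_sq_norm (by fun_prop)).2 hs

theorem integrable_integral_belief (E : Experiment d) {g : State d → ℝ}
    (hg : Integrable g (prior d)) :
    Integrable (fun s => ∫ ω, g ω ∂(E.belief s)) E.signalLaw := by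
  have h := E.integrable_of_prior hg
  rw [Measure.comp_eq_comp_const_apply] at h
  have h' := h.integral_comp
  rwa [Kernel.const_apply] at h'

theorem integral_integral_belief (E : Experiment d) {g : State d → ℝ}
    (hg : Integrable g (prior d)) :
    ∫ s, ∫ ω, g ω ∂(E.belief s) ∂E.signalLaw = ∫ ω, g ω ∂(prior d) := by
  have h := E.integrable_of_prior hg
  rw [Measure.comp_eq_comp_const_apply] at h
  have h' := Kernel.integral_comp h
  rw [← Measure.comp_eq_comp_const_apply, posterior_comp_signalLaw, Kernel.const_apply] at h'
  exact h'.symm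

theorem memLp_mean (E : Experiment d) : MemLp E.mean 2 E.signalLaw := by
  have hm : AEStronglyMeasurable E.mean E.signalLaw := by
    have : StronglyMeasurable (fun p : E.Signal × State d => p.2) :=
      measurable_snd.stronglyMeasurable
    exact (this.integral_kernel_prod_right' (κ := posterior E.π (prior d))).aestronglyMeasurable
  rw [memLp_two_iff_integrable_sq_norm hm]
  have h : Integrable (fun ω : State d => ‖ω‖ ^ 2) (prior d) :=
    (memLp_id_prior d).norm.integrable_sq
  refine (E.integrable_integral_belief h).mono' (hm.norm.pow 2) ?_
  filter_upwards [E.ae_memLp_belief] with s hs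
  rw [Real.norm_of_nonneg (by positivity)]
  exact sq_norm_integral_le hs

theorem memLp_inner_mean (E : Experiment d) (θ : State d) :
    MemLp (fun s => (inner ℝ θ (E.mean s) : ℝ)) 2 E.signalLaw :=
  (innerSL ℝ θ).comp_memLp' E.memLp_mean

/-- The posterior second moments of θᵀω average to the prior one, ‖θ‖², which is minus the baseline.
-/
theorem value_eq (E : Experiment d) (θ : State d) : E.value θ = E.gain θ + baseline θ := by
  have h : Integrable (fun ω : State d => (inner ℝ θ ω : ℝ) ^ 2) (prior d) :=
    (memLp_inner (memLp_id_prior d) θ).integrable_sq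
  have : E.value θ = ∫ s, ((inner ℝ θ (E.mean s) : ℝ) ^ 2
      - ∫ ω, (inner ℝ θ ω : ℝ) ^ 2 ∂(E.belief s)) ∂E.signalLaw := by
    unfold value
    refine integral_congr_ae ?_
    filter_upwards [E.ae_memLp_belief] with s hs
    rw [optimalUtility_eq hs]; rfl
  rw [this, integral_sub (E.memLp_inner_mean θ).integrable_sq (E.integrable_integral_belief h),
    E.integral_integral_belief h, integral_sq_inner_prior, baseline_eq, gain]
  ring

theorem gain_nonneg (E : Experiment d) (θ : State d) : 0 ≤ E.gain θ :=
  integral_nonneg fun _ => sq_nonneg _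

theorem gain_le (E : Experiment d) (θ : State d) : E.gain θ ≤ ‖θ‖ ^ 2 := by
  have h : Integrable (fun ω : State d => (inner ℝ θ ω : ℝ) ^ 2) (prior d) :=
    (memLp_inner (memLp_id_prior d) θ).integrable_sq
  rw [← integral_sq_inner_prior, ← E.integral_integral_belief h]
  refine integral_mono_ae (E.memLp_inner_mean θ).integrable_sq (E.integrable_integral_belief h) ?_
  filter_upwards [E.ae_memLp_belief] with s hs
  exact sq_inner_integral_le hs θ

/-- The Cauchy–Schwarz inequality for the covariance form of the posterior mean. -/
theorem sq_integral_mul_le (E : Experiment d) (θ η : State d) :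
    (∫ s, (inner ℝ θ (E.mean s) : ℝ) * inner ℝ η (E.mean s) ∂E.signalLaw) ^ 2 ≤
      E.gain θ * E.gain η := by
  have h1 := (E.memLp_inner_mean θ).integrable_sq
  have h2 := (E.memLp_inner_mean η).integrable_sq
  have h12 : Integrable (fun s => (inner ℝ θ (E.mean s) : ℝ) * inner ℝ η (E.mean s)) E.signalLaw :=
    (E.memLp_inner_mean θ).integrable_mul (E.memLp_inner_mean η)
  -- The quadratic is the gain at xθ + η; nonnegativity bounds its discriminant.
  have key : ∀ x : ℝ, 0 ≤ E.gain θ * (x * x) +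
      (2 * ∫ s, (inner ℝ θ (E.mean s) : ℝ) * inner ℝ η (E.mean s) ∂E.signalLaw) * x
        + E.gain η := by
    intro x
    have : 0 ≤ E.gain (x • θ + η) := E.gain_nonneg _
    have e : E.gain (x • θ + η) = ∫ s, (x ^ 2 * (inner ℝ θ (E.mean s) : ℝ) ^ 2 +
        (2 * x) * ((inner ℝ θ (E.mean s) : ℝ) * inner ℝ η (E.mean s)) +
        (inner ℝ η (E.mean s) : ℝ) ^ 2) ∂E.signalLaw := by
      unfold gain
      congr 1; ext s
      rw [inner_add_left, real_inner_smul_left]; ring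
    have h3 := h1.const_mul (x ^ 2)
    have h4 := h12.const_mul (2 * x)
    have h34 : Integrable (fun s => x ^ 2 * (inner ℝ θ (E.mean s) : ℝ) ^ 2 +
        (2 * x) * ((inner ℝ θ (E.mean s) : ℝ) * inner ℝ η (E.mean s))) E.signalLaw := h3.add h4
    rw [e, integral_add h34 h2, integral_add h3 h4, integral_const_mul, integral_const_mul]
      at this
    unfold gain
    linarith
  have := discrim_le_zero key
  unfold discrim at this
  linarith

theorem integrable_inner_smul_mean (E : Experiment d) (θ : State d) :
    Integrable (fun s => (inner ℝ θ (E.mean s) : ℝ) • E.mean s) E.signalLaw := by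
  have h : MemLp ((fun s => (inner ℝ θ (E.mean s) : ℝ)) • E.mean) 1 E.signalLaw :=
    MemLp.smul (p := 2) (q := 2) E.memLp_mean (E.memLp_inner_mean θ)
  exact memLp_one_iff_integrable.1 h

/-- A single linear signal that is as good as `E` for `θ` and no better than `E` for anyone. -/
theorem exists_linear_signal (E : Experiment d) (θ : State d) :
    ∃ v : State d, ‖v‖ ≤ 1 ∧ 0 ≤ (inner ℝ v θ : ℝ) ∧ (inner ℝ v θ : ℝ) ^ 2 = E.gain θ ∧
      ∀ η : State d, (inner ℝ v η : ℝ) ^ 2 ≤ E.gain η := by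
  rcases (E.gain_nonneg θ).eq_or_lt with h0 | h0
  · exact ⟨0, by simp, by simp, by simpa using h0, fun η => by simpa using E.gain_nonneg η⟩
  -- This is Cθ; the witness is Cθ/√(θᵀCθ).
  set w : State d := ∫ s, (inner ℝ θ (E.mean s) : ℝ) • E.mean s ∂E.signalLaw with hw
  have hint := E.integrable_inner_smul_mean θ
  have hwη : ∀ η : State d, (inner ℝ w η : ℝ) =
      ∫ s, (inner ℝ θ (E.mean s) : ℝ) * inner ℝ η (E.mean s) ∂E.signalLaw := by
    intro η
    rw [real_inner_comm, hw, ← integral_inner hint]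
    simp_rw [real_inner_smul_right]
  have hwθ : (inner ℝ w θ : ℝ) = E.gain θ := by
    rw [hwη]; unfold gain; simp_rw [sq]
  have hr : 0 < √(E.gain θ) := Real.sqrt_pos.2 h0
  have hrr : √(E.gain θ) ^ 2 = E.gain θ := Real.sq_sqrt h0.le
  have hall : ∀ η : State d, (inner ℝ ((√(E.gain θ))⁻¹ • w) η : ℝ) ^ 2 ≤ E.gain η := by
    intro η
    rw [real_inner_smul_left, mul_pow, inv_pow, hrr, inv_mul_le_iff₀ h0, hwη]
    exact E.sq_integral_mul_le θ η
  refine ⟨(√(E.gain θ))⁻¹ • w, ?_, ?_, ?_, hall⟩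
  -- Testing the domination at η = v gives ‖v‖⁴ ≤ ‖v‖².
  · set v := (√(E.gain θ))⁻¹ • w
    have h := (hall v).trans (E.gain_le v)
    rw [real_inner_self_eq_norm_sq] at h
    by_contra! hv
    have h1 : 1 < ‖v‖ ^ 2 := one_lt_pow₀ hv two_ne_zero
    nlinarith
  · rw [real_inner_smul_left, hwθ]; positivity
  · rw [real_inner_smul_left, hwθ, mul_pow, inv_pow, hrr]
    field_simp

/-! ### Noiseless linear signals -/

/-- The projection theorem for the standard Gaussian, by reflection in the line through `v`. -/
theorem setIntegral_prior_preimage {v : State d} (hv : ‖v‖ = 1) {A : Set ℝ}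
    (hA : MeasurableSet A) :
    ∫ ω in (fun ω => (inner ℝ v ω : ℝ)) ⁻¹' A, ω ∂(prior d) =
      ∫ ω in (fun ω => (inner ℝ v ω : ℝ)) ⁻¹' A, (inner ℝ v ω : ℝ) • v ∂(prior d) := by
  set B := (fun ω : State d => (inner ℝ v ω : ℝ)) ⁻¹' A
  have hB : MeasurableSet B := by
    have : Measurable (fun ω : State d => (inner ℝ v ω : ℝ)) := by fun_prop
    exact this hA
  set R := (ℝ ∙ v).reflection
  have hR : ∀ ω, R ω = (2 : ℝ) • (inner ℝ v ω : ℝ) • v - ω := by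
    intro ω
    rw [Submodule.reflection_singleton_apply, hv]
    simp [two_smul]
  have hRv : ∀ ω, (inner ℝ v (R ω) : ℝ) = inner ℝ v ω := by
    intro ω
    rw [hR, inner_sub_right, real_inner_smul_right, real_inner_smul_right,
      real_inner_self_eq_norm_sq, hv]
    ring
  have hmp : MeasurePreserving R (prior d) (prior d) :=
    ⟨R.continuous.measurable, stdGaussian_map R⟩
  have hpre : R ⁻¹' B = B := by
    ext ω; simp [B, hRv]
  have h1 : Integrable (fun ω : State d => ω) (prior d) :=
    (memLp_id_prior d).integrable (by norm_num)
  have h2 : Integrable (fun ω : State d => (inner ℝ v ω : ℝ) • v) (prior d) :=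
    ((memLp_inner (memLp_id_prior d) v).integrable (by norm_num)).smul_const v
  -- The reflection preserves both the prior and B; expanding Rω = 2(vᵀω)v − ω then gives the claim.
  have e : ∫ ω in B, R ω ∂(prior d) = ∫ ω in B, ω ∂(prior d) := by
    have := hmp.setIntegral_preimage_emb R.toHomeomorph.measurableEmbedding (fun ω => ω) B
    rwa [hpre] at this
  simp_rw [hR] at e
  have h3 : Integrable (fun ω : State d => (2 : ℝ) • (inner ℝ v ω : ℝ) • v) (prior d) :=
    h2.smul (2 : ℝ)
  rw [integral_sub h3.integrableOn h1.integrableOn, integral_smul,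
    sub_eq_iff_eq_add, ← two_smul ℝ (∫ ω in B, ω ∂(prior d))] at e
  exact (smul_right_injective _ (two_ne_zero' ℝ) e).symm

/-- The kernel that reveals `vᵀ ω` without noise. -/
abbrev linearKernel (v : State d) : Kernel (State d) ℝ :=
  Kernel.deterministic (fun ω : State d => (inner ℝ v ω : ℝ)) (by fun_prop)

theorem linearKernel_comp_prior (v : State d) :
    linearKernel v ∘ₘ prior d = (prior d).map (fun ω => (inner ℝ v ω : ℝ)) :=
  Measure.deterministic_comp_eq_map _

theorem compProd_posterior_linearKernel (v : State d) :
    (linearKernel v ∘ₘ prior d) ⊗ₘ (posterior (linearKernel v) (prior d)) =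
      (prior d).map (fun ω => ((inner ℝ v ω : ℝ), ω)) := by
  rw [compProd_posterior_eq_map_swap, Measure.compProd_deterministic,
    Measure.map_map (by fun_prop) (by fun_prop)]
  rfl

/-- Both sides have the same integral over every measurable set of signals, by
`setIntegral_prior_preimage`. -/
theorem integral_posterior_linearKernel {v : State d} (hv : ‖v‖ = 1)
    (hint : Integrable (fun s => ∫ ω, ω ∂(posterior (linearKernel v) (prior d) s))
      (linearKernel v ∘ₘ prior d)) :
    ∀ᵐ s ∂(linearKernel v ∘ₘ prior d),
      ∫ ω, ω ∂(posterior (linearKernel v) (prior d) s) = s • v := by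
  have hmeas : Measurable (fun ω : State d => (inner ℝ v ω : ℝ)) := by fun_prop
  have hs : Integrable (fun s : ℝ => s • v) (linearKernel v ∘ₘ prior d) := by
    rw [linearKernel_comp_prior]
    exact (integrable_map_measure (by fun_prop) hmeas.aemeasurable).2
      (((memLp_inner (memLp_id_prior d) v).integrable (by norm_num)).smul_const v)
  refine Integrable.ae_eq_of_forall_setIntegral_eq _ _ hint hs ?_
  intro A hA _
  have h1 : Integrable (fun p : ℝ × State d => p.2)
      ((prior d).map (fun ω => ((inner ℝ v ω : ℝ), ω))) :=
    (integrable_map_measure (by fun_prop) (by fun_prop)).2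
      ((memLp_id_prior d).integrable (by norm_num))
  have h2 := Measure.setIntegral_compProd (μ := linearKernel v ∘ₘ prior d)
    (κ := posterior (linearKernel v) (prior d)) (f := fun p => p.2) hA MeasurableSet.univ
    (by rw [compProd_posterior_linearKernel]; exact h1.integrableOn)
  rw [compProd_posterior_linearKernel] at h2
  simp only [Measure.restrict_univ] at h2
  rw [← h2, setIntegral_map (hA.prod MeasurableSet.univ) (by fun_prop) (by fun_prop),
    linearKernel_comp_prior, setIntegral_map hA (by fun_prop) hmeas.aemeasurable,
    ← setIntegral_prior_preimage hv hA]
  congr 2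
  ext; simp

theorem scalarGaussian_zero_π (v : State d) : (scalarGaussian v 0).π = linearKernel v := by
  refine Kernel.ext fun ω => ?_
  exact (gaussianReal_zero_var _).trans (Kernel.deterministic_apply _ _).symm

theorem isDeterministic_scalarGaussian_zero (v : State d) :
    (scalarGaussian v 0).IsDeterministic :=
  ⟨fun ω => (inner ℝ v ω : ℝ), (by fun_prop : Measurable fun ω : State d => (inner ℝ v ω : ℝ)),
    fun _ => gaussianReal_zero_var _⟩

theorem gain_scalarGaussian_zero {v : State d} (hv : ‖v‖ = 1) (θ : State d) :
    (scalarGaussian v 0).gain θ = (inner ℝ v θ : ℝ) ^ 2 := by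
  have hπ : (scalarGaussian v 0).π = linearKernel v := scalarGaussian_zero_π v
  have hmeas : Measurable (fun ω : State d => (inner ℝ v ω : ℝ)) := by fun_prop
  have hint : Integrable (scalarGaussian v 0).mean (scalarGaussian v 0).signalLaw :=
    (scalarGaussian v 0).memLp_mean.integrable (by norm_num)
  have hg : (scalarGaussian v 0).gain θ = ∫ s, (inner ℝ θ (∫ ω, ω ∂(posterior (linearKernel v)
      (prior d) s)) : ℝ) ^ 2 ∂(linearKernel v ∘ₘ prior d) := by
    unfold gain mean belief signalLaw
    simp only [hπ]
    rfl
  have hint' : Integrable (fun s => ∫ ω, ω ∂(posterior (linearKernel v) (prior d) s))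
      (linearKernel v ∘ₘ prior d) := by
    unfold mean belief signalLaw at hint
    simp only [hπ] at hint
    exact hint
  have hae : ∫ s, (inner ℝ θ (∫ ω, ω ∂(posterior (linearKernel v) (prior d) s)) : ℝ) ^ 2
      ∂(linearKernel v ∘ₘ prior d) =
      ∫ s : ℝ, s ^ 2 * (inner ℝ v θ : ℝ) ^ 2 ∂(linearKernel v ∘ₘ prior d) := by
    refine integral_congr_ae ?_
    filter_upwards [integral_posterior_linearKernel hv hint'] with s hs
    rw [hs, real_inner_smul_right, mul_pow, real_inner_comm]
  rw [hg, hae, linearKernel_comp_prior, integral_map hmeas.aemeasurable (by fun_prop),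
    integral_mul_const, integral_sq_inner_prior, hv]
  ring

end Experiment

/-! ### Normalizing signals to unit length -/

/-- The other types span at most n − 1 < d dimensions, and the sign of u is free. -/
theorem exists_ne_zero_orthogonal {n : ℕ} (hnd : n ≤ d) (θ : Fin n → State d) (i : Fin n) :
    ∃ u : State d, u ≠ 0 ∧ 0 ≤ (inner ℝ u (θ i) : ℝ) ∧ ∀ j, j ≠ i → (inner ℝ u (θ j) : ℝ) = 0 := by
  classical
  set s : Finset (State d) := (Finset.univ.erase i).image θ
  set W := Submodule.span ℝ (s : Set (State d))
  have hW : W ≠ ⊤ := by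
    intro h
    have h1 : Module.finrank ℝ W ≤ s.card := finrank_span_finset_le_card s
    have h2 : s.card ≤ (Finset.univ.erase i).card := Finset.card_image_le
    rw [Finset.card_erase_of_mem (Finset.mem_univ i), Finset.card_univ, Fintype.card_fin] at h2
    rw [h, finrank_top, finrank_euclideanSpace_fin] at h1
    have := i.pos
    omega
  obtain ⟨u, hu, hu0⟩ := Submodule.exists_mem_ne_zero_of_ne_bot
    (mt (Submodule.orthogonal_eq_bot_iff (K := W)).1 hW)
  have hperp : ∀ j, j ≠ i → (inner ℝ u (θ j) : ℝ) = 0 := fun j hj =>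
    (Submodule.mem_orthogonal' W u).1 hu _ (Submodule.subset_span
      (Finset.mem_coe.2 (Finset.mem_image_of_mem θ (by simp [hj]))))
  rcases le_total 0 (inner ℝ u (θ i) : ℝ) with h | h
  · exact ⟨u, hu0, h, hperp⟩
  · exact ⟨-u, neg_ne_zero.2 hu0, by simpa using h, fun j hj => by simp [hperp j hj]⟩

theorem exists_nonneg_norm_add_smul_eq_one {v u : State d} (hv : ‖v‖ ≤ 1) (hu : u ≠ 0) :
    ∃ r : ℝ, 0 ≤ r ∧ ‖v + r • u‖ = 1 := by
  have hu' : 0 < ‖u‖ := norm_pos_iff.2 hu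
  have hcont : ContinuousOn (fun r : ℝ => ‖v + r • u‖) (Set.Icc 0 (2 / ‖u‖)) := by fun_prop
  -- The added vector has length 2 and ‖v‖ ≤ 1.
  have h2 : 1 ≤ ‖v + (2 / ‖u‖) • u‖ := by
    have h := norm_sub_le (v + (2 / ‖u‖) • u) v
    rw [add_sub_cancel_left, norm_smul, Real.norm_of_nonneg (by positivity),
      div_mul_cancel₀ _ hu'.ne'] at h
    linarith
  obtain ⟨r, hr, hr1⟩ := intermediate_value_Icc (by positivity) hcont
    (show (1 : ℝ) ∈ Set.Icc _ _ from ⟨by simpa using hv, h2⟩)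
  exact ⟨r, hr.1, hr1⟩

/-- A signal can be normalized by raising the value of one type only. -/
theorem exists_unit_signal {n : ℕ} (hnd : n ≤ d) (θ : Fin n → State d) (i : Fin n)
    {v : State d} (hv : ‖v‖ ≤ 1) :
    ∃ w : State d, ‖w‖ = 1 ∧ (inner ℝ v (θ i) : ℝ) ≤ inner ℝ w (θ i) ∧
      ∀ j, j ≠ i → (inner ℝ w (θ j) : ℝ) = inner ℝ v (θ j) := by
  obtain ⟨u, hu, hui, huj⟩ := exists_ne_zero_orthogonal hnd θ i
  obtain ⟨r, hr, hr1⟩ := exists_nonneg_norm_add_smul_eq_one hv hu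
  refine ⟨v + r • u, hr1, ?_, fun j hj => ?_⟩
  · rw [inner_add_left, real_inner_smul_left]
    have := mul_nonneg hr hui
    linarith
  · rw [inner_add_left, real_inner_smul_left, huj j hj]; simp

/-! ### Linear mechanisms and menus -/

/-- Incentive compatible and individually rational direct mechanisms that sell to type `i` the
noiseless signal in the direction `p.1 i` at the price `p.2 i`. -/
def linearMechanisms {n : ℕ} (θ : Fin n → State d) :
    Set ((Fin n → State d) × (Fin n → ℝ)) :=
  {p | (∀ i, ‖p.1 i‖ = 1) ∧ (∀ i, 0 ≤ p.2 i) ∧ (∀ i, p.2 i ≤ (inner ℝ (p.1 i) (θ i) : ℝ) ^ 2) ∧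
    ∀ i j, (inner ℝ (p.1 j) (θ i) : ℝ) ^ 2 - p.2 j ≤ (inner ℝ (p.1 i) (θ i) : ℝ) ^ 2 - p.2 i}

/-- The constraints are closed, and individual rationality bounds the price for type i by ‖θ i‖². -/
theorem isCompact_linearMechanisms {n : ℕ} (θ : Fin n → State d) :
    IsCompact (linearMechanisms θ) := by
  have hK : IsCompact ((Set.univ.pi fun _ : Fin n => Metric.sphere (0 : State d) 1) ×ˢ
      (Set.univ.pi fun i : Fin n => Set.Icc (0 : ℝ) (‖θ i‖ ^ 2))) :=
    (isCompact_univ_pi fun _ => isCompact_sphere _ _).prod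
      (isCompact_univ_pi fun _ => isCompact_Icc)
  refine hK.of_isClosed_subset ?_ ?_
  · unfold linearMechanisms
    simp only [Set.ofPred_and, Set.ofPred_forall]
    refine (isClosed_iInter fun i => isClosed_eq (by fun_prop) (by fun_prop)).inter
      ((isClosed_iInter fun i => isClosed_le (by fun_prop) (by fun_prop)).inter
      ((isClosed_iInter fun i => isClosed_le (by fun_prop) (by fun_prop)).inter
      (isClosed_iInter fun i => isClosed_iInter fun j => isClosed_le (by fun_prop) (by fun_prop))))
  · rintro ⟨w, t⟩ ⟨hw, ht0, ht, -⟩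
    refine ⟨fun i _ => by simpa using hw i, fun i _ => ⟨ht0 i, (ht i).trans ?_⟩⟩
    have h := abs_real_inner_le_norm (w i) (θ i)
    rw [show ‖w i‖ = 1 from hw i, one_mul] at h
    exact sq_le_sq' (abs_le.1 h).1 (abs_le.1 h).2

namespace Menu

variable (M : Menu d)

/-- The gain in utility, gross of the payment, from a choice. -/
def choiceGain (θ : State d) : M.Choice → ℝ
  | none => 0
  | some E => E.1.gain θ

theorem netUtility_eq (θ : State d) (x : M.Choice) :
    M.netUtility θ x = M.choiceGain θ x - M.payment x + baseline θ := by
  cases x with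
  | none => simp [netUtility, choiceGain, payment]
  | some E =>
    simp only [netUtility, choiceGain, payment, E.1.value_eq]
    ring

theorem payment_nonneg (x : M.Choice) : 0 ≤ M.payment x := by
  cases x with
  | none => exact le_rfl
  | some E => exact (M.price E).2

theorem exists_linear_signal_of_choice (θ : State d) (x : M.Choice) :
    ∃ v : State d, ‖v‖ ≤ 1 ∧ 0 ≤ (inner ℝ v θ : ℝ) ∧ (inner ℝ v θ : ℝ) ^ 2 = M.choiceGain θ x ∧
      ∀ η : State d, (inner ℝ v η : ℝ) ^ 2 ≤ M.choiceGain η x := by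
  cases x with
  -- Not buying counts as the zero signal; its later normalization is why every type ends up buying.
  | none => exact ⟨0, by simp [choiceGain]⟩
  | some E => exact E.1.exists_linear_signal θ

/-- Any menu is dominated by a direct mechanism that sells noiseless linear signals. -/
theorem exists_linearMechanism_payment_le {n : ℕ} (hnd : n ≤ d) (θ : Fin n → State d)
    {c : Fin n → M.Choice} (hc : M.IsOptimalChoice θ c) :
    ∃ p ∈ linearMechanisms θ, ∀ i, M.payment (c i) ≤ p.2 i := by
  choose v hv1 hv0 hvi hv using fun i => M.exists_linear_signal_of_choice (θ i) (c i)
  choose w hw1 hwi hwj using fun i => exists_unit_signal hnd θ i (hv1 i)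
  have hgain : ∀ i, M.choiceGain (θ i) (c i) ≤ (inner ℝ (w i) (θ i) : ℝ) ^ 2 := fun i => by
    rw [← hvi]; exact pow_le_pow_left₀ (hv0 i) (hwi i) 2
  have hopt : ∀ i x, M.choiceGain (θ i) x - M.payment x ≤
      M.choiceGain (θ i) (c i) - M.payment (c i) := fun i x => by
    have := hc i x
    rw [netUtility_eq, netUtility_eq] at this
    linarith
  -- The price rises by exactly the buyer's extra gain, leaving each type's net utility unchanged.
  refine ⟨⟨w, fun i => M.payment (c i) +
    ((inner ℝ (w i) (θ i) : ℝ) ^ 2 - M.choiceGain (θ i) (c i))⟩, ⟨hw1, ?_, ?_, ?_⟩, ?_⟩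
  · intro i
    have := M.payment_nonneg (c i)
    have := hgain i
    dsimp only
    linarith
  · intro i
    have h := hopt i none
    simp only [choiceGain, payment] at h ⊢
    linarith
  · intro i j
    rcases eq_or_ne i j with rfl | hij
    · exact le_rfl
    -- For type i the item of j is worth no more than the choice `c j` was, and it costs no less.
    have h1 := hopt i (c j)
    have h2 := hgain j
    have h3 := hv j (θ i)
    dsimp only
    rw [hwj j i hij]
    linarith
  · intro i
    have := hgain i
    dsimp only
    linarith

end Menu

theorem linearMechanisms_nonempty {n : ℕ} (hnd : n ≤ d) (θ : Fin n → State d) :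
    (linearMechanisms θ).Nonempty := by
  let M : Menu d := ⟨∅, fun _ => 0⟩
  have hc : M.IsOptimalChoice θ (fun _ => none) := by
    rintro i (_ | ⟨E, hE⟩)
    · exact le_rfl
    · exact absurd hE (Set.notMem_empty E)
  obtain ⟨p, hp, -⟩ := M.exists_linearMechanism_payment_le hnd θ hc
  exact ⟨p, hp⟩

open Experiment in
/-- A direct mechanism that sells noiseless linear signals is implemented by a menu. -/
theorem exists_menu_of_linearMechanism {n : ℕ} {θ : Fin n → State d}
    {p : (Fin n → State d) × (Fin n → ℝ)} (hp : p ∈ linearMechanisms θ) :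
    ∃ (M : Menu d) (c : Fin n → M.experiments),
      M.IsOptimalChoice θ (fun i => some (c i)) ∧ (∀ i, M.payment (some (c i)) = p.2 i) ∧
      Function.Surjective c ∧ ∀ i, (c i : Experiment d) = scalarGaussian (p.1 i) 0 := by
  obtain ⟨hw, ht0, ht, hic⟩ := hp
  -- Several types may share one experiment; incentive compatibility makes their prices agree, so
  -- the index picked by `choose` is immaterial.
  have hle : ∀ i j, scalarGaussian (p.1 i) 0 = scalarGaussian (p.1 j) 0 → p.2 i ≤ p.2 j := by
    intro i j h
    have h1 := hic i j
    rw [← gain_scalarGaussian_zero (hw i), ← gain_scalarGaussian_zero (hw j), h] at h1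
    linarith
  let M : Menu d :=
    { experiments := Set.range fun i => scalarGaussian (p.1 i) 0
      price := fun E => ⟨p.2 E.2.choose, ht0 _⟩ }
  let c : Fin n → M.experiments := fun i => ⟨scalarGaussian (p.1 i) 0, i, rfl⟩
  have hpay : ∀ i, M.payment (some (c i)) = p.2 i := by
    intro i
    have h : scalarGaussian (p.1 (c i).2.choose) 0 = scalarGaussian (p.1 i) 0 :=
      (c i).2.choose_spec
    exact le_antisymm (hle _ _ h) (hle _ _ h.symm)
  have hsurj : Function.Surjective c := by
    rintro ⟨_, i, rfl⟩
    exact ⟨i, rfl⟩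
  have hgain : ∀ i η, M.choiceGain η (some (c i)) = (inner ℝ (p.1 i) η : ℝ) ^ 2 :=
    fun i η => gain_scalarGaussian_zero (hw i) η
  refine ⟨M, c, ?_, hpay, hsurj, fun i => rfl⟩
  rintro i (_ | E)
  · rw [M.netUtility_eq, M.netUtility_eq, hpay, hgain]
    have := ht i
    simp only [Menu.choiceGain, Menu.payment]
    linarith
  · obtain ⟨j, rfl⟩ := hsurj E
    rw [M.netUtility_eq, M.netUtility_eq, hpay, hgain, hpay, hgain]
    have := hic i j
    linarith

end DataMarket

end

/-- Types `i : Fin n` with preference vectors `θ i ∈ ℝ^d` and probabilities `f i`; `n ≤ d`.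
There is a revenue-maximizing menu of deterministic experiments, in which type `i` buys the
experiment `c i`, and every experiment on the menu is bought by some type. -/
theorem theorem5 (n d : ℕ) (hnd : n ≤ d) (θ : Fin n → DataMarket.State d) (f : Fin n → ℝ)
    (hf : ∀ i, 0 ≤ f i) (hf_sum : ∑ i, f i = 1) :
    ∃ (M : DataMarket.Menu d) (c : Fin n → M.experiments),
      M.IsRevenueMaximizing f θ (fun i => some (c i)) ∧
      Function.Surjective c ∧
      ∀ E ∈ M.experiments, E.IsDeterministic ∧
        ∃ v : DataMarket.State d, ‖v‖ = 1 ∧ E = DataMarket.Experiment.scalarGaussian v 0 := by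
  obtain ⟨p, hp, hmax⟩ := (DataMarket.isCompact_linearMechanisms θ).exists_isMaxOn
    (DataMarket.linearMechanisms_nonempty hnd θ)
    (f := fun p => ∑ i, f i * p.2 i) (by fun_prop)
  obtain ⟨M, c, hopt, hpay, hsurj, hc⟩ := DataMarket.exists_menu_of_linearMechanism hp
  refine ⟨M, c, ⟨hopt, fun M' c' hc' => ?_⟩, hsurj, fun E hE => ?_⟩
  · obtain ⟨q, hq, hle⟩ := M'.exists_linearMechanism_payment_le hnd θ hc'
    calc M'.revenue f c' ≤ ∑ i, f i * q.2 i :=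
          Finset.sum_le_sum fun i _ => mul_le_mul_of_nonneg_left (hle i) (hf i)
      _ ≤ ∑ i, f i * p.2 i := hmax hq
      _ = M.revenue f (fun i => some (c i)) := by
          simp only [DataMarket.Menu.revenue, hpay]
  · obtain ⟨i, hi⟩ := hsurj ⟨E, hE⟩
    obtain rfl : E = DataMarket.Experiment.scalarGaussian (p.1 i) 0 := by rw [← hc i, hi]
    exact ⟨DataMarket.Experiment.isDeterministic_scalarGaussian_zero _, p.1 i, hp.1 i, rfl⟩
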